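/- For integers $p,q\ge 1$, a Sylvester matrix of type $(p,q)$ is a matrix in $\mathbb C^{(p+q)\times(p+q)}$ whose first $q$ rows are $(a_0,a_1,\dots,a_p,0,\dots,0)$ and its successive shifts to the right by one place, and whose last $p$ rows are $(b_0,b_1,\dots,b_q,0,\dots,0)$ and its successive shifts to the right by one place, where $a_0,\dots,a_p,b_0,\dots,b_q\in\mathbb C$ are arbitrary. A subvariety of $\mathbb C^m/\mathfrak S(m)$, the space of multisets of $m$ complex numbers, is the set of common zeros of a family of symmetric polynomials in $m$ variables; a property holds for a generic multiset if the multisets that do not satisfy it are contained in a proper subvariety of $\mathbb C^m/\mathfrak S(m)$. Let $m\ge 2$ be an integer. For a generic multiset $S\in\mathbb C^m/\mathfrak S(m)$ the following holds: for all integers $p,q\ge 1$ with $p+q=m$ there exists a Sylvester matrix $A\in\mathbb C^{m\times m}$ of type $(p,q)$ whose multiset of eigenvalues, counted with algebraic multiplicities, is $S$. -/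

import Mathlib

/-- The Sylvester matrices of size `q + p` with `q` rows of coefficients `a_0, …, a_p` followed by
`p` rows of coefficients `b_0, …, b_q`, each row in a block being the previous one shifted one step
to the right. Mathlib's `Polynomial.sylvester` puts the coefficients in columns, hence the
transpose; no coefficient is required to be nonzero. -/
def IsSylvesterMatrix (p q : ℕ) (A : Matrix (Fin (q + p)) (Fin (q + p)) ℂ) : Prop :=
  ∃ a b : Polynomial ℂ, a.natDegree ≤ p ∧ b.natDegree ≤ q ∧
    A = (Polynomial.sylvester b a q p).transpose

/-- The unordered tuple (multiset of total multiplicity `m`) underlying a vector of `ℂ^m`, that is,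
the quotient map `ℂ^m → ℂ^m / 𝔖(m)`. -/
def unorderedTuple {m : ℕ} (v : Fin m → ℂ) : Sym ℂ m :=
  ⟨(Finset.univ : Finset (Fin m)).val.map v, by simp⟩

/-- The common zeros in `ℂ^m / 𝔖(m)` of a set of polynomials; it is used for symmetric polynomials,
whose value at an unordered tuple does not depend on the ordering. -/
def symZeroLocus {m : ℕ} (F : Set (MvPolynomial (Fin m) ℂ)) : Set (Sym ℂ m) :=
  {S | ∀ v : Fin m → ℂ, unorderedTuple v = S → ∀ f ∈ F, MvPolynomial.eval v f = 0}

/-- Subvarieties (Zariski closed subsets) of `ℂ^m / 𝔖(m)`, whose coordinate ring is the ring of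
symmetric polynomials in `m` variables. -/
def IsSymSubvariety {m : ℕ} (Z : Set (Sym ℂ m)) : Prop :=
  ∃ F : Set (MvPolynomial (Fin m) ℂ), (∀ f ∈ F, f.IsSymmetric) ∧ Z = symZeroLocus F

/-- A property holds for a generic multiset of `m` complex numbers if the multisets that do not
satisfy it are contained in a proper subvariety of `ℂ^m / 𝔖(m)`. -/
def HoldsForGenericMultiset {m : ℕ} (P : Sym ℂ m → Prop) : Prop :=
  ∃ Z : Set (Sym ℂ m), IsSymSubvariety Z ∧ Z ≠ Set.univ ∧ ∀ S : Sym ℂ m, ¬ P S → S ∈ Z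

/-! If `b(y) = y ^ q * a(y)`, then `(1, y, y ^ 2, …)` is an eigenvector of the Sylvester matrix with
eigenvalue `a(y)`. Any monic `h` of degree `p + q` can be written as `b - X ^ q * a` with `a(0) =
0`. If its roots are `-x i`, the resulting eigenvalues are `x i * ∂ e_p / ∂ x i`, where `e_p` is the
elementary symmetric polynomial. It remains to see that this map from `x` to eigenvalues is
dominant. At `x = (1, …, 1)` its Jacobian is the Gram matrix of the incidence between points and
`p`-subsets, invertible for `1 ≤ p < m`. The Jacobian criterion and Chevalley's theorem then give a
nonempty basic open set in the image. Intersecting over `p`, requiring distinct entries and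
symmetrizing yields the generic condition. -/

/-! ### Jacobian criterion and dominant maps -/

open MvPolynomial in
theorem MvPolynomial.totalDegree_pderiv_lt {σ R : Type*} [CommSemiring R] {i : σ}
    {P : MvPolynomial σ R} (h : pderiv i P ≠ 0) : (pderiv i P).totalDegree < P.totalDegree := by
  classical
  have key : ∀ b ∈ (pderiv i P).support, (b.sum fun _ e => e) + 1 ≤ P.totalDegree := by
    intro b hb
    rw [mem_support_iff, coeff_pderiv] at hb
    have hb' : b + Finsupp.single i 1 ∈ P.support := mem_support_iff.2 (left_ne_zero_of_mul hb)
    have := le_totalDegree hb'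
    rwa [Finsupp.sum_add_index' (fun _ => rfl) (fun _ _ _ => rfl),
      Finsupp.sum_single_index rfl] at this
  obtain ⟨b, hb⟩ := support_nonempty.2 h
  have hpos := key b hb
  rw [totalDegree, Finset.sup_lt_iff (by simp only [bot_eq_zero]; omega)]
  exact fun b hb => key b hb

open MvPolynomial in
theorem MvPolynomial.eq_C_of_pderiv_eq_zero {σ K : Type*} [Field K] [CharZero K]
    {P : MvPolynomial σ K} (h : ∀ i, pderiv i P = 0) : P = C (coeff 0 P) := by
  classical
  ext b
  rw [coeff_C]
  split_ifs with hb
  · rw [hb]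
  · obtain ⟨i, hi⟩ := Finsupp.ne_iff.1 (Ne.symm hb)
    have hc := congrArg (coeff (b - Finsupp.single i 1)) (h i)
    have hle : Finsupp.single i 1 ≤ b := by
      rw [Finsupp.single_le_iff]
      exact Nat.one_le_iff_ne_zero.2 hi
    rw [coeff_pderiv, tsub_add_cancel_of_le hle, coeff_zero] at hc
    exact (mul_eq_zero.1 hc).resolve_right (Nat.cast_add_one_ne_zero _)

open MvPolynomial in
theorem MvPolynomial.pderiv_aeval {σ τ R : Type*} [Fintype σ] [CommRing R]
    (G : σ → MvPolynomial τ R) (j : τ) (P : MvPolynomial σ R) :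
    pderiv j (aeval G P) = ∑ i, aeval G (pderiv i P) * pderiv j (G i) := by
  classical
  induction P using MvPolynomial.induction_on with
  | C a => simp
  | add P Q hP hQ => simp only [map_add, hP, hQ, add_mul, Finset.sum_add_distrib]
  | mul_X P k hP =>
    simp only [map_mul, aeval_X, pderiv_mul, hP, map_add, add_mul, Finset.sum_add_distrib,
      Finset.sum_mul]
    congr 1
    · exact Finset.sum_congr rfl fun i _ => by ring
    · rw [Finset.sum_eq_single k]
      · simp
      · intro i _ hi
        simp [pderiv_X_of_ne (Ne.symm hi)]
      · simp

open MvPolynomial in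
/-- **Jacobian criterion**: polynomials whose Jacobian determinant does not vanish at some point are
algebraically independent. -/
theorem MvPolynomial.algebraicIndependent_of_jacobian_ne_zero {σ K : Type*} [Fintype σ]
    [DecidableEq σ] [Field K] [CharZero K] (G : σ → MvPolynomial σ K) (x : σ → K)
    (hdet : (Matrix.of fun i j => eval x (pderiv j (G i))).det ≠ 0) :
    AlgebraicIndependent K G := by
  have hdet' : (Matrix.of fun i j => pderiv j (G i)).det ≠ 0 := by
    intro h
    apply hdet
    have := congrArg (eval x) h
    rw [RingHom.map_det, map_zero] at this
    exact this
  rw [algebraicIndependent_iff]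
  suffices H : ∀ n, ∀ P : MvPolynomial σ K, P.totalDegree = n → aeval G P = 0 → P = 0 from
    fun P hP => H _ P rfl hP
  intro n
  induction n using Nat.strong_induction_on with
  | _ n ih =>
    intro P hn hP
    -- By the chain rule, the Jacobian matrix kills this vector, so each partial derivative of `P`
    -- is a relation of smaller degree.
    have hv : (fun i => aeval G (pderiv i P)) = 0 := by
      refine Matrix.eq_zero_of_vecMul_eq_zero hdet' ?_
      funext j
      have := pderiv_aeval G j P
      rw [hP, map_zero] at this
      simpa [Matrix.vecMul, dotProduct] using this.symm
    have hd : ∀ i, pderiv i P = 0 := by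
      intro i
      by_contra hi
      exact hi (ih _ (hn ▸ totalDegree_pderiv_lt hi) _ rfl (congrFun hv i))
    have hC := eq_C_of_pderiv_eq_zero hd
    rw [hC, aeval_C] at hP
    rw [hC, (map_eq_zero_iff _ (FaithfulSMul.algebraMap_injective K (MvPolynomial σ K))).1 hP,
      map_zero]

open MvPolynomial in
/-- A dominant polynomial map contains a nonempty basic open set in its image. -/
theorem MvPolynomial.exists_forall_eval_ne_zero_exists_eval_eq {σ τ K : Type*} [Finite σ] [Finite τ]
    [Field K] [IsAlgClosed K] (G : τ → MvPolynomial σ K) (hG : AlgebraicIndependent K G) :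
    ∃ g : MvPolynomial τ K, g ≠ 0 ∧
      ∀ v : τ → K, eval v g ≠ 0 → ∃ x : σ → K, ∀ i, eval x (G i) = v i := by
  have hinj : Function.Injective (aeval G : MvPolynomial τ K →ₐ[K] MvPolynomial σ K) := hG
  set φ : MvPolynomial τ K →+* MvPolynomial σ K := (aeval G : _ →ₐ[K] _).toRingHom with hφ
  have hfin : φ.FinitePresentation := by
    refine RingHom.FinitePresentation.of_finiteType.1 ?_
    refine RingHom.FiniteType.of_comp_finiteType (f := C) (g := φ) ?_
    have : φ.comp C = C := by ext1 a; simp [hφ]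
    rw [this]
    exact RingHom.finiteType_algebraMap.2 (inferInstance : Algebra.FiniteType K (MvPolynomial σ K))
  obtain ⟨S, hS⟩ := PrimeSpectrum.exists_constructibleSetData_iff.2
    (PrimeSpectrum.isConstructible_range_comap hfin)
  -- The generic point lies in the image; the constructible piece containing it must be a basic open
  -- set.
  have hbot : (⊥ : PrimeSpectrum (MvPolynomial τ K)) ∈ S.toSet := by
    rw [hS]
    refine ⟨⊥, PrimeSpectrum.ext ?_⟩
    exact (RingHom.injective_iff_ker_eq_bot φ).1 hinj
  obtain ⟨D, hDS, hD⟩ := Set.mem_iUnion₂.1 hbot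
  have hg0 : ∀ i, D.g i = 0 := fun i => by simpa using hD.1 ⟨i, rfl⟩
  refine ⟨D.f, fun h => hD.2 (by simp [h]), fun v hv => ?_⟩
  let P : PrimeSpectrum (MvPolynomial τ K) := ⟨vanishingIdeal K {v}, inferInstance⟩
  have hP : P ∈ S.toSet := by
    refine Set.mem_iUnion₂.2 ⟨D, hDS, ?_, ?_⟩
    · rintro _ ⟨i, rfl⟩
      rw [hg0 i]
      exact P.asIdeal.zero_mem
    · intro h
      have := h (Set.mem_singleton D.f)
      exact hv (by simpa [P, mem_vanishingIdeal_singleton_iff, aeval_eq_eval] using this)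
  rw [hS] at hP
  obtain ⟨Q, hQ⟩ := hP
  obtain ⟨M, hM, hQM⟩ := Q.asIdeal.exists_le_maximal Q.2.ne_top
  obtain ⟨x, rfl⟩ := isMaximal_iff_eq_vanishingIdeal_singleton.1 hM
  refine ⟨x, fun i => ?_⟩
  have h1 : X i - C (v i) ∈ P.asIdeal := by
    simp [P]
  rw [← hQ] at h1
  have h2 := hQM h1
  rw [mem_vanishingIdeal_singleton_iff] at h2
  simpa [hφ, sub_eq_zero, aeval_eq_eval] using h2

/-! ### Dominance of the eigenvalue map -/

open MvPolynomial in
/-- The sum of all squarefree monomials of degree `p` divisible by `X i`, i.e. the logarithmic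
derivative `X i * ∂ esymm p / ∂ X i` of the elementary symmetric polynomial. -/
noncomputable def esymmLogDeriv (m p : ℕ) (i : Fin m) : MvPolynomial (Fin m) ℂ :=
  ∑ t ∈ (Finset.univ.powersetCard p).filter (i ∈ ·), ∏ k ∈ t, X k

open MvPolynomial in
theorem eval_one_pderiv_prod_X {σ R : Type*} [DecidableEq σ] [CommSemiring R] (t : Finset σ)
    (j : σ) : eval 1 (pderiv j (∏ k ∈ t, X k : MvPolynomial σ R)) = if j ∈ t then 1 else 0 := by
  induction t using Finset.induction_on with
  | empty => simp
  | insert a s ha ih =>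
    rw [Finset.prod_insert ha, pderiv_mul, map_add, map_mul, map_mul, ih, eval_X, map_prod]
    by_cases hja : j = a
    · subst hja; simp [ha]
    · simp [hja, pderiv_X_of_ne (Ne.symm hja)]

/-- Inside a set of `p + 1` points, deleting one leaves sum zero, so every value equals the total
`T`. Hence `T = (p + 1) T`, and `T = 0`. -/
theorem eq_zero_of_sum_powersetCard_eq_zero {σ K : Type*} [Fintype σ] [DecidableEq σ] [Field K]
    [CharZero K] {p : ℕ} (hp : 1 ≤ p) (hpm : p < Fintype.card σ) (v : σ → K)
    (hv : ∀ t : Finset σ, t.card = p → ∑ i ∈ t, v i = 0) : v = 0 := by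
  funext i
  obtain ⟨s, his, hs⟩ := Finset.exists_superset_card_eq (s := {i}) (n := p + 1)
    (by simp) (by simpa using hpm)
  have hT : ∀ k ∈ s, v k = ∑ j ∈ s, v j := by
    intro k hk
    rw [← Finset.add_sum_erase s v hk, hv _ (by rw [Finset.card_erase_of_mem hk, hs]; rfl),
      add_zero]
  have h := Finset.sum_congr rfl hT
  rw [Finset.sum_const, hs, nsmul_eq_mul] at h
  have hT0 : ∑ j ∈ s, v j = 0 := by
    have : (p : K) * ∑ j ∈ s, v j = 0 := by push_cast at h; linear_combination -h
    exact (mul_eq_zero.1 this).resolve_left (by exact_mod_cast (by omega : p ≠ 0))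
  rw [hT i (his (Finset.mem_singleton_self i)), hT0, Pi.zero_apply]

open MvPolynomial in
open scoped ComplexOrder in
theorem algebraicIndependent_esymmLogDeriv {m p : ℕ} (hp : 1 ≤ p) (hpm : p < m) :
    AlgebraicIndependent ℂ (esymmLogDeriv m p) := by
  refine algebraicIndependent_of_jacobian_ne_zero _ 1 fun hdet => ?_
  -- Entry `(i, j)` of the Jacobian at the all-ones point counts the `p`-subsets containing both `i`
  -- and `j`.
  let N : Matrix (Finset (Fin m)) (Fin m) ℂ := fun t i => if t.card = p ∧ i ∈ t then 1 else 0
  have hJ : (Matrix.of fun i j => eval 1 (pderiv j (esymmLogDeriv m p i))) =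
      N.conjTranspose * N := by
    ext i j
    rw [Matrix.of_apply, esymmLogDeriv, map_sum, map_sum]
    simp only [eval_one_pderiv_prod_X, Matrix.mul_apply, Matrix.conjTranspose_apply]
    rw [Finset.sum_filter, ← Finset.sum_subset (Finset.subset_univ (Finset.univ.powersetCard p))]
    · refine Finset.sum_congr rfl fun t ht => ?_
      have : t.card = p := (Finset.mem_powersetCard.1 ht).2
      by_cases hi : i ∈ t <;> simp [N, this, hi]
    · intro t _ ht
      have : t.card ≠ p := by simpa [Finset.mem_powersetCard] using ht
      simp [N, this]
  rw [hJ] at hdet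
  obtain ⟨v, hv0, hv⟩ := Matrix.exists_mulVec_eq_zero_iff.2 hdet
  rw [Matrix.conjTranspose_mul_self_mulVec_eq_zero] at hv
  refine hv0 (eq_zero_of_sum_powersetCard_eq_zero hp (by simpa using hpm) v fun t ht => ?_)
  have := congrFun hv t
  simpa [N, Matrix.mulVec, dotProduct, ht, ite_mul, ← Finset.sum_filter] using this

theorem Finset.mul_sum_powersetCard_erase_prod {σ R : Type*} [Fintype σ] [DecidableEq σ]
    [CommSemiring R] (x : σ → R) (p : ℕ) (i : σ) :
    x i * ∑ t ∈ (Finset.univ.erase i).powersetCard p, ∏ k ∈ t, x k =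
      ∑ t ∈ (Finset.univ.powersetCard (p + 1)).filter (i ∈ ·), ∏ k ∈ t, x k := by
  rw [Finset.mul_sum]
  refine Finset.sum_bij' (fun t _ => insert i t) (fun t _ => t.erase i) ?_ ?_ ?_ ?_ ?_
  · intro t ht
    rw [Finset.mem_powersetCard] at ht
    have hi : i ∉ t := fun h => by simpa using ht.1 h
    simp [Finset.card_insert_of_notMem hi, ht.2]
  · intro t ht
    simp only [Finset.mem_filter, Finset.mem_powersetCard] at ht
    rw [Finset.mem_powersetCard, Finset.card_erase_of_mem ht.2, ht.1.2]
    exact ⟨Finset.erase_subset_erase _ (Finset.subset_univ _), rfl⟩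
  · intro t ht
    rw [Finset.mem_powersetCard] at ht
    exact Finset.erase_insert fun h => by simpa using ht.1 h
  · intro t ht
    simp only [Finset.mem_filter] at ht
    exact Finset.insert_erase ht.2
  · intro t ht
    rw [Finset.mem_powersetCard] at ht
    rw [Finset.prod_insert fun h => by simpa using ht.1 h]

/-! ### Sylvester matrices with prescribed eigenvalues -/

open Polynomial in
/-- The values at a root `y` of `g * (X - y)` of the part of this product of degree above `q`,
divided by `X ^ q`. -/
theorem Polynomial.sum_coeff_mul_X_sub_C_mul_pow {R : Type*} [CommRing R] (g : R[X]) (y : R)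
    (p q : ℕ) :
    ∑ k ∈ Finset.range p, (g * (X - C y)).coeff (q + (k + 1)) * y ^ (k + 1) =
      y * g.coeff q - g.coeff (q + p) * y ^ (p + 1) := by
  induction p with
  | zero => simp [mul_comm]
  | succ p ih =>
    rw [Finset.sum_range_succ, ih, ← add_assoc, coeff_mul_X_sub_C, add_assoc]
    ring

open Polynomial in
theorem exists_polynomials_eval_eq_esymmLogDeriv {p q : ℕ} (hp : 1 ≤ p) (hq : 1 ≤ q)
    (x : Fin (p + q) → ℂ) :
    ∃ a b : ℂ[X], a.natDegree ≤ p ∧ b.natDegree ≤ q ∧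
      ∀ i, a.eval (-x i) = MvPolynomial.eval x (esymmLogDeriv (p + q) p i) ∧
        b.eval (-x i) = (-x i) ^ q * a.eval (-x i) := by
  set h : ℂ[X] := ∏ j, (X + C (x j)) with hh
  have hdeg : h.natDegree = p + q := by
    rw [hh, natDegree_prod_of_monic _ _ fun i _ => monic_X_add_C (x i)]
    simp
  -- Chosen so that `X ^ q * a` cancels the terms of `h` of degree above `q`.
  set a : ℂ[X] := -∑ k ∈ Finset.range p, C (h.coeff (q + (k + 1))) * X ^ (k + 1) with ha
  have hacoeff : ∀ n, a.coeff (n + 1) = -h.coeff (q + (n + 1)) := by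
    intro n
    simp only [ha, coeff_neg, finsetSum_coeff, coeff_C_mul_X_pow, add_left_inj]
    rw [Finset.sum_ite_eq]
    split_ifs with hn
    · rfl
    · rw [coeff_eq_zero_of_natDegree_lt (p := h)]
      rw [Finset.mem_range] at hn
      omega
  refine ⟨a, X ^ q * a + h, ?_, ?_, fun i => ⟨?_, ?_⟩⟩
  · rw [ha, natDegree_neg]
    refine natDegree_sum_le_of_forall_le _ _ fun k hk => ?_
    rw [Finset.mem_range] at hk
    exact (natDegree_C_mul_X_pow_le _ _).trans (by omega)
  · refine natDegree_le_iff_coeff_eq_zero.2 fun n hn => ?_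
    obtain ⟨k, rfl⟩ := Nat.exists_eq_add_of_lt hn
    rw [coeff_add, add_assoc, coeff_X_pow_mul', if_pos (by omega), Nat.add_sub_cancel_left, hacoeff,
      neg_add_cancel]
  · have hfac : h = (∏ j ∈ Finset.univ.erase i, (X + C (x j))) * (X - C (-x i)) := by
      rw [C_neg, sub_neg_eq_add, hh, Finset.prod_erase_mul _ _ (Finset.mem_univ i)]
    have hcard : (Finset.univ.erase i).card = p + q - 1 := by
      rw [Finset.card_erase_of_mem (Finset.mem_univ i), Finset.card_univ, Fintype.card_fin]
    have hlast : (∏ j ∈ Finset.univ.erase i, (X + C (x j))).coeff (q + p) = 0 := by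
      refine coeff_eq_zero_of_natDegree_lt ?_
      rw [natDegree_prod_of_monic _ _ fun i _ => monic_X_add_C (x i)]
      simp only [natDegree_X_add_C, Finset.sum_const, hcard, smul_eq_mul]
      omega
    have hval : a.eval (-x i) = x i * (∏ j ∈ Finset.univ.erase i, (X + C (x j))).coeff q := by
      rw [ha]
      simp only [eval_neg, eval_finsetSum, eval_mul, eval_C, eval_pow, eval_X]
      rw [hfac, sum_coeff_mul_X_sub_C_mul_pow, hlast]
      ring
    rw [hval, Finset.prod_X_add_C_coeff _ _ (by omega), hcard,
      Finset.mul_sum_powersetCard_erase_prod, esymmLogDeriv]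
    simp [show p + q - 1 - q + 1 = p by omega]
  · have : h.eval (-x i) = 0 := by
      rw [hh, eval_prod]
      exact Finset.prod_eq_zero (Finset.mem_univ i) (by simp)
    simp [this]

open Polynomial in
theorem Polynomial.sum_shifted_coeff_mul_pow {R : Type*} [CommSemiring R] {N d s : ℕ} (f : R[X])
    (hf : f.natDegree ≤ d) (hs : s + d < N) (y : R) :
    ∑ c : Fin N, (if (c : ℕ) ∈ Set.Icc s (s + d) then f.coeff (c - s) else 0) * y ^ (c : ℕ) =
      y ^ s * f.eval y := by
  rw [Fin.sum_univ_eq_sum_range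
    (fun c => (if c ∈ Set.Icc s (s + d) then f.coeff (c - s) else 0) * y ^ c),
    eval_eq_sum_range' (Nat.lt_succ_of_le hf), Finset.mul_sum]
  simp only [ite_mul, zero_mul]
  rw [← Finset.sum_filter]
  refine Finset.sum_bij' (fun c _ => c - s) (fun k _ => s + k) ?_ ?_ ?_ ?_ ?_
  · intro c hc
    simp only [Finset.mem_filter, Set.mem_Icc, Finset.mem_range] at hc ⊢
    omega
  · intro k hk
    simp only [Finset.mem_filter, Set.mem_Icc, Finset.mem_range] at hk ⊢
    omega
  · intro c hc
    simp only [Finset.mem_filter, Set.mem_Icc, Finset.mem_range] at hc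
    omega
  · intro k _
    omega
  · intro c hc
    simp only [Finset.mem_filter, Set.mem_Icc, Finset.mem_range] at hc
    obtain ⟨k, rfl⟩ := Nat.exists_eq_add_of_le hc.2.1
    rw [Nat.add_sub_cancel_left]
    ring

open Polynomial in
/-- If `b(y) = y ^ q * a(y)` then `(1, y, y ^ 2, …)` is an eigenvector of the Sylvester matrix of
`a` and `b` for the eigenvalue `a(y)`. -/
theorem Polynomial.sylvester_transpose_mulVec_pow {R : Type*} [CommRing R] {p q : ℕ} {a b : R[X]}
    (ha : a.natDegree ≤ p) (hb : b.natDegree ≤ q) {y : R} (hy : b.eval y = y ^ q * a.eval y) :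
    Matrix.mulVec (sylvester b a q p).transpose (fun r => y ^ (r : ℕ)) =
      a.eval y • fun r : Fin (q + p) => y ^ (r : ℕ) := by
  funext r
  simp only [Matrix.mulVec, dotProduct, Matrix.transpose_apply, sylvester, Matrix.of_apply,
    Pi.smul_apply, smul_eq_mul]
  refine Fin.addCases (fun r => ?_) (fun r => ?_) r
  · simp only [Fin.addCases_left, Fin.val_castAdd]
    rw [sum_shifted_coeff_mul_pow a ha (by omega), mul_comm]
  · simp only [Fin.addCases_right, Fin.val_natAdd]
    rw [sum_shifted_coeff_mul_pow b hb (by omega), hy]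
    ring

theorem Matrix.isRoot_charpoly_of_mulVec_eq_smul {n R : Type*} [Fintype n] [DecidableEq n]
    [CommRing R] [IsDomain R] {A : Matrix n n R} {w : n → R} {μ : R} (hw : w ≠ 0)
    (h : A.mulVec w = μ • w) : A.charpoly.IsRoot μ := by
  rw [Polynomial.IsRoot, Matrix.eval_charpoly]
  refine Matrix.exists_mulVec_eq_zero_iff.1 ⟨w, hw, ?_⟩
  rw [Matrix.sub_mulVec, h, Matrix.scalar_apply, ← Matrix.smul_one_eq_diagonal, Matrix.smul_mulVec,
    Matrix.one_mulVec, sub_self]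

theorem Matrix.charpoly_roots_eq_of_injective {n ι R : Type*} [Fintype n] [Fintype ι]
    [DecidableEq n] [CommRing R] [IsDomain R] (A : Matrix n n R) (v : ι → R)
    (hcard : Fintype.card ι = Fintype.card n) (hv : Function.Injective v)
    (h : ∀ i, A.charpoly.IsRoot (v i)) : A.charpoly.roots = Finset.univ.val.map v := by
  symm
  refine Multiset.eq_of_le_of_card_le ?_ ?_
  · refine (Multiset.le_iff_subset (Finset.univ.nodup.map hv)).2 fun y hy => ?_
    obtain ⟨i, -, rfl⟩ := Multiset.mem_map.1 hy
    exact (Polynomial.mem_roots A.charpoly_monic.ne_zero).2 (h i)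
  · refine (Polynomial.card_roots' _).trans ?_
    rw [Matrix.charpoly_natDegree_eq_dim]
    simp [hcard]

theorem exists_isSylvesterMatrix_charpoly_roots {p q : ℕ} (hp : 1 ≤ p) (hq : 1 ≤ q)
    (x v : Fin (p + q) → ℂ) (hx : ∀ i, MvPolynomial.eval x (esymmLogDeriv (p + q) p i) = v i)
    (hv : Function.Injective v) :
    ∃ A : Matrix (Fin (q + p)) (Fin (q + p)) ℂ,
      IsSylvesterMatrix p q A ∧ A.charpoly.roots = Finset.univ.val.map v := by
  obtain ⟨a, b, ha, hb, hab⟩ := exists_polynomials_eval_eq_esymmLogDeriv hp hq x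
  refine ⟨_, ⟨a, b, ha, hb, rfl⟩,
    Matrix.charpoly_roots_eq_of_injective _ v (by simp [add_comm]) hv fun i => ?_⟩
  have h := Polynomial.sylvester_transpose_mulVec_pow ha hb (hab i).2
  rw [(hab i).1, hx] at h
  refine Matrix.isRoot_charpoly_of_mulVec_eq_smul (fun h0 => ?_) h
  simpa using congrFun h0 ⟨0, by omega⟩

/-! ### Symmetrization and genericity -/

open MvPolynomial in
theorem MvPolynomial.isSymmetric_prod_rename {σ R : Type*} [Fintype σ] [DecidableEq σ]
    [CommSemiring R] (g : MvPolynomial σ R) :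
    (∏ e : Equiv.Perm σ, rename e g).IsSymmetric := by
  intro τ
  rw [map_prod, ← Equiv.prod_comp (Equiv.mulLeft τ) fun e : Equiv.Perm σ => rename e g]
  refine Finset.prod_congr rfl fun e _ => ?_
  rw [rename_rename]
  rfl

open MvPolynomial in
theorem HoldsForGenericMultiset.of_forall_eval_ne_zero {m : ℕ} {P : Sym ℂ m → Prop}
    {g : MvPolynomial (Fin m) ℂ} (hg : g ≠ 0)
    (h : ∀ v : Fin m → ℂ, eval v g ≠ 0 → P (unorderedTuple v)) : HoldsForGenericMultiset P := by
  set f := ∏ e : Equiv.Perm (Fin m), rename e g with hf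
  have hf0 : f ≠ 0 := Finset.prod_ne_zero_iff.2 fun e _ =>
    (map_ne_zero_iff _ (rename_injective _ e.injective)).2 hg
  refine ⟨symZeroLocus {f}, ⟨{f}, ?_, rfl⟩, fun huniv => hf0 ?_, fun S hS v hv f' hf' => ?_⟩
  · rintro _ rfl
    exact isSymmetric_prod_rename g
  · refine MvPolynomial.funext fun v => ?_
    rw [map_zero]
    exact (huniv ▸ Set.mem_univ (unorderedTuple v) : unorderedTuple v ∈ symZeroLocus {f}) v rfl f
      rfl
  · rw [Set.mem_singleton_iff.1 hf']
    by_contra hne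
    rw [hf, map_prod, ← ne_eq, Finset.prod_ne_zero_iff] at hne
    have h1 := hne 1 (Finset.mem_univ _)
    rw [Equiv.Perm.coe_one, rename_id_apply] at h1
    exact hS (hv ▸ h v h1)

open MvPolynomial in
theorem exists_ne_zero_forall_eval_ne_zero_injective (m : ℕ) (K : Type*) [Field K] :
    ∃ g : MvPolynomial (Fin m) K, g ≠ 0 ∧ ∀ v, eval v g ≠ 0 → Function.Injective v := by
  refine ⟨∏ i, ∏ j ∈ Finset.univ.erase i, (X i - X j), ?_, fun v hv i j hij => ?_⟩
  · refine Finset.prod_ne_zero_iff.2 fun i _ => Finset.prod_ne_zero_iff.2 fun j hj => ?_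
    rw [sub_ne_zero]
    exact fun h => Finset.ne_of_mem_erase hj (X_injective h).symm
  · by_contra hne
    rw [map_prod, Finset.prod_ne_zero_iff] at hv
    have h1 := hv i (Finset.mem_univ i)
    rw [map_prod, Finset.prod_ne_zero_iff] at h1
    exact h1 j (Finset.mem_erase.2 ⟨Ne.symm hne, Finset.mem_univ j⟩) (by simp [hij])

theorem proposition3p6 (m : ℕ) (hm : 2 ≤ m) :
    HoldsForGenericMultiset (fun S : Sym ℂ m =>
      ∀ p q : ℕ, 1 ≤ p → 1 ≤ q → p + q = m →
        ∃ A : Matrix (Fin (q + p)) (Fin (q + p)) ℂ,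
          IsSylvesterMatrix p q A ∧ A.charpoly.roots = (S : Multiset ℂ)) := by
  obtain ⟨d, hd0, hd⟩ := exists_ne_zero_forall_eval_ne_zero_injective m ℂ
  have H : ∀ p : ℕ, ∃ g : MvPolynomial (Fin m) ℂ, g ≠ 0 ∧ (1 ≤ p → p < m → ∀ v : Fin m → ℂ,
      MvPolynomial.eval v g ≠ 0 → ∃ x, ∀ i, MvPolynomial.eval x (esymmLogDeriv m p i) = v i) := by
    intro p
    by_cases hp : 1 ≤ p ∧ p < m
    · obtain ⟨g, hg0, hg⟩ := MvPolynomial.exists_forall_eval_ne_zero_exists_eval_eq _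
        (algebraicIndependent_esymmLogDeriv hp.1 hp.2)
      exact ⟨g, hg0, fun _ _ => hg⟩
    -- A dummy factor, needed because the product below also includes `p = 0`.
    · exact ⟨1, one_ne_zero, fun h1 h2 => absurd ⟨h1, h2⟩ hp⟩
  choose g hg0 hg using H
  refine HoldsForGenericMultiset.of_forall_eval_ne_zero (g := d * ∏ p ∈ Finset.range m, g p)
    (mul_ne_zero hd0 (Finset.prod_ne_zero_iff.2 fun p _ => hg0 p)) ?_
  intro v hv p q hp hq hpq
  rw [map_mul, map_prod] at hv
  have hvp := Finset.prod_ne_zero_iff.1 (right_ne_zero_of_mul hv) p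
    (Finset.mem_range.2 (by omega))
  obtain ⟨x, hx⟩ := hg p hp (by omega) v hvp
  subst hpq
  exact exists_isSylvesterMatrix_charpoly_roots hp hq x v hx (hd v (left_ne_zero_of_mul hv))
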